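/- Let $\mathcal P$ be the set of all integer partitions, including the empty partition, and let $|\lambda|$ denote the size of a partition $\lambda$; for a finite family $X$ of partitions let $|X|$ be the sum of the sizes of its members. Let $t\ge 2$ be an integer. A partition is a $t$-core if none of the hook lengths of its Young diagram is divisible by $t$; the $t$-core of $\lambda$ is the $t$-core obtained from $\lambda$ by successively deleting hooks of length divisible by $t$. The $t$-quotient of $\lambda$ is the $t$-tuple of partitions obtained as follows: take a set $B$ of beta numbers $\{\lambda_i+N-i : 1\le i\le N\}$ of $\lambda$ (with $\lambda_i=0$ beyond the last part), where $N$ is a multiple of $t$ that is at least the number of parts of $\lambda$; for $0\le r<t$ the $r$-th entry of the tuple is the partition with set of beta numbers $\{x : tx+r\in B\}$. Define rows of partitions by $\alpha_0=(\lambda)$ and letting $\alpha_{j+1}$ be the concatenation, in order, of the $t$-quotients of the partitions in $\alpha_j$; the $j$-th row $\beta_j=\beta_j(t;\lambda)$ of the $t$-core tower of $\lambda$ consists of the $t$-cores of the partitions in $\alpha_j$. Then for every $\lambda$ only finitely many $|\beta_j|$ are nonzero. Define the $t$-defect $$d_t(\lambda)=\frac{|\lambda|-\sum_{j\ge 0}|\beta_j(t;\lambda)|}{t-1},$$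 and put $D_t(q)=\sum_{\lambda\in\mathcal P}d_t(\lambda)q^{|\lambda|}$, $G_2^0(q)=\sum_{n\ge1}\sigma_1(n)q^n$ with $\sigma_1(n)=\sum_{d\mid n}d$, and $(q)_\infty=\prod_{j\ge1}(1-q^j)$. Then for all $t\ge 2$ the series $\sum_{j\ge1}t^jG_2^0(q^{t^j})$ converges as a formal power series in $q$, and, as formal power series with rational coefficients, $$D_t(q)=\frac{\sum_{j\geq1}t^j\,G_2^0\left(q^{t^j}\right)}{(q)_\infty}.$$ -/

import Mathlib

open scoped PowerSeries PowerSeries.WithPiTopology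

namespace CoreTower

/-! Partitions are handled through their Young diagrams (English convention, rows and columns
numbered from `0`); the size of a partition is the number of cells `YoungDiagram.card`. -/

/-- The Young diagram of a partition of `n`: its rows are the parts in weakly decreasing order. -/
def diagram {n : ℕ} (p : n.Partition) : YoungDiagram :=
  YoungDiagram.ofRowLens (p.parts.sort (· ≥ ·)) (p.parts.pairwise_sort (· ≥ ·)).sortedGE

/-- The hook length of a cell: the number of cells to its right, plus the number of cells below
it, plus one. -/
def hookLength (μ : YoungDiagram) (c : ℕ × ℕ) : ℕ :=
  (μ.rowLen c.1 - (c.2 + 1)) + (μ.colLen c.2 - (c.1 + 1)) + 1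

/-- A partition is a `t`-core if none of its hook lengths is divisible by `t`. -/
def IsCore (t : ℕ) (μ : YoungDiagram) : Prop :=
  ∀ c ∈ μ, ¬ t ∣ hookLength μ c

/-- Deletion of the hook of the cell `c = (i, j)`: the cells of the rim hook of `c` are removed,
that is, the cells weakly below and weakly to the right of `c` that have no cell of `μ` diagonally
below and to the right of them. (This is the same as removing the hook itself and then
pushing the detached lower right piece one step up and one step to the left.) -/
def deleteHook (μ : YoungDiagram) (c : ℕ × ℕ) : YoungDiagram where
  cells := μ.cells.filter fun x => ¬ (c.1 ≤ x.1 ∧ c.2 ≤ x.2 ∧ (x.1 + 1, x.2 + 1) ∉ μ)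
  isLowerSet := by
    rintro ⟨a, b⟩ ⟨a', b'⟩ ⟨ha, hb⟩ h
    simp only [Finset.coe_filter, Set.mem_ofPred_eq, YoungDiagram.mem_cells] at h ⊢
    obtain ⟨hm, hn⟩ := h
    simp only at ha hb hn ⊢
    refine ⟨μ.up_left_mem ha hb hm, fun ⟨h1, h2, h3⟩ => hn ⟨by omega, by omega, fun h4 => h3 ?_⟩⟩
    exact μ.up_left_mem (by omega) (by omega) h4

/-- `ν` arises from `μ` by deleting one hook whose length is divisible by `t`. -/
def DeleteStep (t : ℕ) (μ ν : YoungDiagram) : Prop :=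
  ∃ c ∈ μ, t ∣ hookLength μ c ∧ ν = deleteHook μ c

theorem card_deleteHook_lt (μ : YoungDiagram) (c : ℕ × ℕ) (hc : c ∈ μ) :
    (deleteHook μ c).card < μ.card := by
  have hex : ∃ k, (c.1 + k + 1, c.2 + k + 1) ∉ μ := by
    obtain ⟨j, hj⟩ := μ.exists_notMem_row 0
    exact ⟨j, fun h => hj (μ.up_left_mem (Nat.zero_le _) (by omega) h)⟩
  classical
  have hk := Nat.find_spec hex
  have hmem : (c.1 + Nat.find hex, c.2 + Nat.find hex) ∈ μ := by
    rcases hz : Nat.find hex with _ | m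
    · exact hc
    · exact not_not.mp (Nat.find_min hex (m := m) (by omega))
  refine Finset.card_lt_card (Finset.filter_ssubset.mpr ⟨_, hmem, ?_⟩)
  simp only [not_not]
  exact ⟨by omega, by omega, hk⟩

/-- Successive deletion of hooks of length divisible by `t` ends in a `t`-core. -/
theorem exists_core (t : ℕ) (μ : YoungDiagram) :
    ∃ ν, Relation.ReflTransGen (DeleteStep t) μ ν ∧ IsCore t ν := by
  induction hn : μ.card using Nat.strong_induction_on generalizing μ with
  | _ n ih =>
    by_cases h : IsCore t μ
    · exact ⟨μ, .refl, h⟩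
    · simp only [IsCore, not_forall, not_not] at h
      obtain ⟨c, hc, ht⟩ := h
      obtain ⟨ν, h1, h2⟩ := ih _ (hn ▸ card_deleteHook_lt μ c hc) _ rfl
      exact ⟨ν, .head ⟨c, hc, ht, rfl⟩ h1, h2⟩

/-- The `t`-core of `μ`: a `t`-core obtained from `μ` by successively deleting hooks of length
divisible by `t`. -/
noncomputable def core (t : ℕ) (μ : YoungDiagram) : YoungDiagram :=
  (exists_core t μ).choose

/-- The set of beta numbers `{μ_i + (N - 1 - i) : 0 ≤ i < N}` of a partition `μ` with at most `N`
nonzero parts `μ_0 ≥ μ_1 ≥ ⋯` (padded with zeros), i.e. the beads of its abacus. -/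
def betaSet (N : ℕ) (μ : YoungDiagram) : Finset ℕ :=
  (Finset.range N).image fun i => μ.rowLen i + (N - 1 - i)

/-- The partition with a given set of beta numbers: every bead `y` contributes a part equal to the
number of vacant positions below `y`. -/
def ofBetaSet (Y : Finset ℕ) : YoungDiagram :=
  YoungDiagram.ofRowLens
    ((Y.sort (· ≥ ·)).map fun y => ((Finset.range y).filter (· ∉ Y)).card)
    (((Y.pairwise_sort (· ≥ ·)).map _ fun a b (hab : a ≥ b) =>
      (Finset.card_le_card (Finset.filter_subset_filter _
        (Finset.range_subset_range.mpr hab)) : _ ≥ _)).sortedGE)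

/-- The `r`-th entry of the `t`-quotient: take a set of beta numbers of `μ` whose number of
elements is a multiple of `t`, and read the beads `t * x + r` on runner `r` of the `t`-abacus as
beta numbers `x`. -/
def quotientEntry (t r : ℕ) (μ : YoungDiagram) : YoungDiagram :=
  ofBetaSet (((betaSet (t * μ.colLen 0) μ).filter (· % t = r)).image (· / t))

/-- The `t`-quotient of `μ`, a `t`-tuple of partitions. -/
def quotient (t : ℕ) (μ : YoungDiagram) : List YoungDiagram :=
  (List.range t).map fun r => quotientEntry t r μ

/-- The `j`-th row of the `t`-core pre-tower of `μ`. -/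
def preTowerRow (t : ℕ) (μ : YoungDiagram) : ℕ → List YoungDiagram
  | 0 => [μ]
  | j + 1 => (preTowerRow t μ j).flatMap (quotient t)

/-- The `j`-th row of the `t`-core tower of `μ`: the `t`-cores of the entries of the `j`-th row of
the pre-tower. -/
noncomputable def towerRow (t : ℕ) (μ : YoungDiagram) (j : ℕ) : List YoungDiagram :=
  (preTowerRow t μ j).map (core t)

/-- The total size of a family of partitions. -/
def totalSize (L : List YoungDiagram) : ℕ := (L.map YoungDiagram.card).sum

/-- The `t`-defect of `μ`, that is `(|μ| - ∑_{j ≥ 0} |β_j|) / (t - 1)`, as a rational number. -/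
noncomputable def defect (t : ℕ) (μ : YoungDiagram) : ℚ :=
  ((μ.card : ℚ) - ∑ᶠ j : ℕ, (totalSize (towerRow t μ j) : ℚ)) / ((t : ℚ) - 1)

/-- The generating function of the `t`-defect, the sum of `d_t(p) q^|p|` over all partitions `p`
(including the empty one). -/
noncomputable def defectSeries (t : ℕ) : ℚ⟦X⟧ :=
  PowerSeries.mk fun n => ∑ p : n.Partition, defect t (diagram p)

/-- `G_2^0(q) = ∑_{n ≥ 1} σ_1(n) q^n`. -/
noncomputable def G20 : ℚ⟦X⟧ :=
  PowerSeries.mk fun n => (ArithmeticFunction.sigma 1 n : ℚ)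

/-- `(q)_∞ = ∏_{j ≥ 0} (1 - q^(j+1))` (a convergent infinite product of formal power series, see
`PowerSeries.WithPiTopology.multipliable_one_sub_X_pow`). -/
noncomputable def qInfty : ℚ⟦X⟧ :=
  ∏' j : ℕ, (1 - PowerSeries.X ^ (j + 1) : ℚ⟦X⟧)

end CoreTower

/-!
The `t`-defect of `μ` is the number of pairs of an exponent `j ≥ 1` and a hook of `μ` whose length is
divisible by `t ^ j`, and hooks are counted over all partitions by moving beads on an abacus.

In terms of beta numbers, a hook of length `h` is a bead `b` with a vacant position `b - h`. Write
`H m` for the number of hooks with length divisible by `m` (`hookCount`); `H 1` is the size. Two beads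
at a distance divisible by `t` lie on the same runner of the `t`-abacus, so the values of `H m` on the
entries of the `t`-quotient add up to `H (t * m)` (`sum_hookCount_quotient`). Hence row `j` of the
pre-tower has total size `H (t ^ j)`. Deleting a hook of length `t * k` moves a bead by `k` steps on
its runner, so it lowers the size by `t * k` and `H t` by `k`, and a core has `H t = 0`; therefore
`|μ| = |core| + t * H t` (`card_eq_card_core_add`). The rows of the tower thus have sizes
`H (t ^ j) - t * H (t ^ (j + 1))`, which telescope to `∑ j ≥ 1, H (t ^ j)` for the defect
(`defect_eq_sum`).

For the generating function, fix a length `L`. A partition has exactly `L` more beads that can move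
up by `L` than beads that can move down by `L` (`card_addable`, `filter_lt_eq_range`), and moving a
marked bead matches the second kind for `n + L` with the first kind for `n`
(`sum_card_removable_add`). So the number of hooks of length `L` in all partitions of `n` is
`L * ∑ k ≥ 1, p(n - k * L)` (`sum_card_removable`). Summing over the multiples `L` of `m` gives
`∑ H m(λ) q^|λ| = m * G20(q^m) * ∑ p(n) q^n` (`sum_partition_hookCount`), to be used for
`m = t ^ j`, and `∑ p(n) q^n` is the inverse of `(q)_∞`.
-/

namespace CoreTower

/-! ### Bead sets and runners -/

/-- The number of pairs `(b, y)` of a bead `b ∈ Y` and a vacant position `y < b` with `m ∣ b - y`.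
For a set of beta numbers of a partition these pairs correspond to the hooks of length divisible
by `m`, see `hookCount`. -/
def invCount (m : ℕ) (Y : Finset ℕ) : ℕ :=
  ∑ b ∈ Y, ((Finset.range b).filter fun y => y ∉ Y ∧ m ∣ b - y).card

/-- Every two-element subset of `Y` is counted once, at its larger element. -/
theorem sum_card_filter_lt (Y : Finset ℕ) :
    ∑ b ∈ Y, (Y.filter (· < b)).card = Y.card.choose 2 := by
  induction Y using Finset.induction_on_max with
  | empty => simp
  | insert a s h ih =>
    have ha : a ∉ s := fun h' => lt_irrefl _ (h a h')
    rw [Finset.sum_insert ha, Finset.card_insert_of_notMem ha, Nat.choose_succ_succ, ← ih,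
      Nat.choose_one_right]
    congr 1
    · congr 1; ext x; simp; grind
    · refine Finset.sum_congr rfl fun b hb => ?_
      congr 1; ext x; simp; have := h b hb; grind

theorem card_vacant_add_card_lt (Y : Finset ℕ) (b : ℕ) :
    ((Finset.range b).filter (· ∉ Y)).card + (Y.filter (· < b)).card = b := by
  have h := Finset.card_filter_add_card_filter_not (s := Finset.range b) (· ∉ Y)
  rw [Finset.card_range] at h
  have h2 : (Finset.range b).filter (fun a => ¬ a ∉ Y) = Y.filter (· < b) := by
    ext x; simp; tauto
  rwa [h2] at h

theorem invCount_one (Y : Finset ℕ) :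
    invCount 1 Y = ∑ b ∈ Y, ((Finset.range b).filter (· ∉ Y)).card := by
  simp [invCount]

theorem invCount_one_add_choose (Y : Finset ℕ) :
    invCount 1 Y + Y.card.choose 2 = ∑ b ∈ Y, b := by
  rw [invCount_one, ← sum_card_filter_lt, ← Finset.sum_add_distrib]
  exact Finset.sum_congr rfl fun b _ => card_vacant_add_card_lt Y b

/-- Passing from `N` to `N + 1` beta numbers of the same partition does not change `invCount`. -/
theorem invCount_shift (m : ℕ) (Y : Finset ℕ) :
    invCount m (insert 0 (Y.image Nat.succ)) = invCount m Y := by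
  rw [invCount, Finset.sum_insert (by simp), Finset.sum_image (by simp)]
  simp only [Finset.range_zero, Finset.filter_empty, Finset.card_empty, zero_add]
  refine Finset.sum_congr rfl fun b _ => ?_
  symm
  refine Finset.card_bij (fun y _ => y + 1) ?_ (by simp) ?_
  · intro y hy
    simp at hy ⊢
    exact hy
  · intro y hy
    rcases y with _ | y
    · simp at hy
    · simp at hy
      exact ⟨y, by simpa using hy, rfl⟩

/-- The bead set on runner `r` of the `t`-abacus: the beads `t * x + r ∈ Y`, read as `x`. -/
def runner (t r : ℕ) (Y : Finset ℕ) : Finset ℕ :=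
  (Y.filter (· % t = r)).image (· / t)

theorem mem_runner {t r : ℕ} (hr : r < t) {Y : Finset ℕ} {x : ℕ} :
    x ∈ runner t r Y ↔ t * x + r ∈ Y := by
  have ht : 0 < t := by omega
  simp only [runner, Finset.mem_image, Finset.mem_filter]
  constructor
  · rintro ⟨b, ⟨hb, rfl⟩, rfl⟩
    rwa [Nat.div_add_mod]
  · intro h
    refine ⟨_, ⟨h, ?_⟩, ?_⟩
    · rw [Nat.mul_add_mod, Nat.mod_eq_of_lt hr]
    · rw [Nat.mul_add_div ht, Nat.div_eq_of_lt hr, add_zero]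

theorem injOn_div_filter_mod (t r : ℕ) (Y : Finset ℕ) :
    Set.InjOn (· / t) (Y.filter (· % t = r) : Set ℕ) := by
  intro a ha b hb h
  simp at ha hb h
  rw [← Nat.div_add_mod a t, ← Nat.div_add_mod b t, h, ha.2, hb.2]

theorem sum_runner {M : Type*} [AddCommMonoid M] (t r : ℕ) (Y : Finset ℕ) (f : ℕ → M) :
    ∑ x ∈ runner t r Y, f x = ∑ b ∈ Y with b % t = r, f (b / t) :=
  Finset.sum_image (injOn_div_filter_mod t r Y)

theorem sum_sum_filter_mod {M : Type*} [AddCommMonoid M] {t : ℕ} (ht : 0 < t) (Y : Finset ℕ)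
    (f : ℕ → M) : ∑ r ∈ Finset.range t, ∑ b ∈ Y with b % t = r, f b = ∑ b ∈ Y, f b :=
  Finset.sum_fiberwise_of_maps_to (fun b _ => Finset.mem_range.mpr (Nat.mod_lt b ht)) f

/-- The pairs counted by `invCount (t * m)` lie on one runner of the `t`-abacus, where the distance is
divided by `t`. -/
theorem sum_invCount_runner {t : ℕ} (ht : 0 < t) (m : ℕ) (Y : Finset ℕ) :
    ∑ r ∈ Finset.range t, invCount m (runner t r Y) = invCount (t * m) Y := by
  refine (Finset.sum_congr rfl fun r hr => ?_).trans (sum_sum_filter_mod ht Y _)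
  rw [Finset.mem_range] at hr
  rw [invCount, sum_runner]
  refine Finset.sum_congr rfl fun b hb => ?_
  obtain ⟨-, rfl⟩ := Finset.mem_filter.mp hb
  have hb := Nat.div_add_mod b t
  refine Finset.card_bij (fun x _ => t * x + b % t) ?_ ?_ ?_
  · intro x hx
    simp only [Finset.mem_filter, Finset.mem_range, mem_runner hr] at hx ⊢
    have h1 : t * x < t * (b / t) := Nat.mul_lt_mul_of_pos_left hx.1 ht
    refine ⟨by omega, hx.2.1, ?_⟩
    rw [show b - (t * x + b % t) = t * (b / t - x) by rw [Nat.mul_sub]; omega]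
    exact Nat.mul_dvd_mul_left t hx.2.2
  · intro x _ y _ h
    exact Nat.eq_of_mul_eq_mul_left ht (by simpa using h)
  · intro y hy
    simp only [Finset.mem_filter, Finset.mem_range] at hy
    obtain ⟨k, hk⟩ := hy.2.2
    have hy' := Nat.div_add_mod y t
    have hmod : y % t = b % t := by
      have : b = y + t * (m * k) := by rw [← mul_assoc, ← hk]; omega
      rw [this, Nat.add_mul_mod_self_left]
    have hlt : t * (y / t) < t * (b / t) := by omega
    have hlt' : y / t < b / t := Nat.lt_of_mul_lt_mul_left hlt
    refine ⟨y / t, ?_, by omega⟩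
    simp only [Finset.mem_filter, Finset.mem_range, mem_runner hr]
    refine ⟨hlt', by rw [← hmod, hy']; exact hy.2.1, ?_⟩
    refine ⟨k, Nat.eq_of_mul_eq_mul_left ht ?_⟩
    rw [Nat.mul_sub, ← mul_assoc, ← hk]
    omega

/-- `invCount m` is determined by `∑ b / m` and the number of beads in each residue class mod `m`;
this makes its change under a move within a class visible. -/
theorem invCount_add_sum_choose {m : ℕ} (hm : 0 < m) (Y : Finset ℕ) :
    invCount m Y + ∑ r ∈ Finset.range m, (Y.filter (· % m = r)).card.choose 2
      = ∑ b ∈ Y, b / m := by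
  have h := sum_invCount_runner hm 1 Y
  rw [mul_one] at h
  rw [← h, ← Finset.sum_add_distrib]
  refine (Finset.sum_congr rfl fun r _ => ?_).trans (sum_sum_filter_mod hm Y _)
  rw [← sum_runner (f := fun x => x), ← invCount_one_add_choose, runner,
    Finset.card_image_of_injOn (injOn_div_filter_mod m r Y)]

/-- The bead set obtained from `Y` by moving the bead `b` to the position `y`. -/
def moveBead (Y : Finset ℕ) (b y : ℕ) : Finset ℕ := insert y (Y.erase b)

theorem sum_moveBead (Y : Finset ℕ) {b y : ℕ} (hb : b ∈ Y) (hy : y ∉ Y) (f : ℕ → ℕ) :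
    ∑ x ∈ moveBead Y b y, f x + f b = ∑ x ∈ Y, f x + f y := by
  rw [moveBead, Finset.sum_insert (by simp [hy]), ← Finset.add_sum_erase Y f hb]
  omega

theorem card_moveBead (Y : Finset ℕ) {b y : ℕ} (hb : b ∈ Y) (hy : y ∉ Y) :
    (moveBead Y b y).card = Y.card := by
  simpa using sum_moveBead Y hb hy fun _ => 1

theorem invCount_moveBead {m : ℕ} (hm : 0 < m) (Y : Finset ℕ) {b k : ℕ} (hb : b + m * k ∈ Y)
    (hy : b ∉ Y) : invCount m (moveBead Y (b + m * k) b) + k = invCount m Y := by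
  have h1 := invCount_add_sum_choose hm Y
  have h2 := invCount_add_sum_choose hm (moveBead Y (b + m * k) b)
  have h3 : ∀ r, ((moveBead Y (b + m * k) b).filter (· % m = r)).card
      = (Y.filter (· % m = r)).card := fun r => by
    have := sum_moveBead Y hb hy fun x => if x % m = r then 1 else 0
    simp only [Finset.card_filter, Nat.add_mul_mod_self_left] at this ⊢
    exact Nat.add_right_cancel this
  have h4 := sum_moveBead Y hb hy (· / m)
  simp only [h3] at h2
  rw [Nat.add_mul_div_left _ _ hm] at h4
  omega

/-! ### Beta numbers of a Young diagram -/

theorem rowLen_eq_zero {μ : YoungDiagram} {i : ℕ} (h : μ.colLen 0 ≤ i) : μ.rowLen i = 0 := by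
  by_contra h0
  have := YoungDiagram.mem_iff_lt_rowLen.mpr (Nat.pos_of_ne_zero h0)
  rw [YoungDiagram.mem_iff_lt_colLen] at this
  omega

theorem card_eq_sum_rowLen {μ : YoungDiagram} {N : ℕ} (h : μ.colLen 0 ≤ N) :
    μ.card = ∑ i ∈ Finset.range N, μ.rowLen i := by
  have hmaps : ∀ c ∈ μ.cells, c.1 ∈ Finset.range N := fun c hc => by
    have h0 : (c.1, 0) ∈ μ := μ.up_left_mem le_rfl (Nat.zero_le c.2) hc
    rw [YoungDiagram.mem_iff_lt_colLen] at h0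
    exact Finset.mem_range.mpr (by omega)
  rw [YoungDiagram.card, Finset.card_eq_sum_card_fiberwise hmaps]
  exact Finset.sum_congr rfl fun i _ => (μ.rowLen_eq_card).symm

theorem colLen_zero_le_card (μ : YoungDiagram) : μ.colLen 0 ≤ μ.card := by
  rw [YoungDiagram.colLen_eq_card]
  exact Finset.card_le_card (Finset.filter_subset _ _)

theorem beta_lt_beta (μ : YoungDiagram) {N i k : ℕ} (hik : i < k) (hk : k < N) :
    μ.rowLen k + (N - 1 - k) < μ.rowLen i + (N - 1 - i) := by
  have := μ.rowLen_anti i k hik.le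
  omega

theorem injOn_beta (μ : YoungDiagram) (N : ℕ) :
    Set.InjOn (fun i => μ.rowLen i + (N - 1 - i)) (Finset.range N : Set ℕ) := by
  intro i hi k hk h
  simp only [Finset.coe_range, Set.mem_Iio] at hi hk h
  rcases lt_trichotomy i k with h' | h' | h'
  · have := beta_lt_beta μ h' hk
    omega
  · exact h'
  · have := beta_lt_beta μ h' hi
    omega

theorem card_betaSet (N : ℕ) (μ : YoungDiagram) : (betaSet N μ).card = N := by
  rw [betaSet, Finset.card_image_of_injOn (injOn_beta μ N), Finset.card_range]

theorem mem_betaSet {N x : ℕ} {μ : YoungDiagram} :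
    x ∈ betaSet N μ ↔ ∃ i < N, μ.rowLen i + (N - 1 - i) = x := by
  simp [betaSet]

theorem invCount_one_betaSet {μ : YoungDiagram} {N : ℕ} (h : μ.colLen 0 ≤ N) :
    invCount 1 (betaSet N μ) = μ.card := by
  have h1 := invCount_one_add_choose (betaSet N μ)
  rw [card_betaSet, betaSet, Finset.sum_image (injOn_beta μ N), Finset.sum_add_distrib,
    ← card_eq_sum_rowLen h, Finset.sum_range_reflect (fun i => i), Finset.sum_range_id,
    ← Nat.choose_two_right] at h1
  exact Nat.add_right_cancel h1

theorem betaSet_succ {μ : YoungDiagram} {N : ℕ} (h : μ.colLen 0 ≤ N) :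
    betaSet (N + 1) μ = insert 0 ((betaSet N μ).image Nat.succ) := by
  ext x
  simp only [Finset.mem_insert, Finset.mem_image, mem_betaSet]
  constructor
  · rintro ⟨i, hi, rfl⟩
    rcases Nat.lt_succ_iff_lt_or_eq.mp hi with hi | rfl
    · exact .inr ⟨_, ⟨i, hi, rfl⟩, by omega⟩
    · exact .inl (by rw [rowLen_eq_zero h]; omega)
  · rintro (rfl | ⟨_, ⟨i, hi, rfl⟩, rfl⟩)
    · exact ⟨N, by omega, by rw [rowLen_eq_zero h]; omega⟩
    · exact ⟨i, by omega, by omega⟩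

/-- The number of hooks of `μ` of length divisible by `m`, defined on the beta numbers: a hook
of length `h` corresponds to a bead `b` and a vacant position `b - h`. Any sufficiently large number
of beta numbers gives the same value, see `invCount_betaSet`. -/
def hookCount (m : ℕ) (μ : YoungDiagram) : ℕ := invCount m (betaSet (μ.colLen 0) μ)

theorem invCount_betaSet (m : ℕ) {μ : YoungDiagram} {N : ℕ} (h : μ.colLen 0 ≤ N) :
    invCount m (betaSet N μ) = hookCount m μ := by
  induction N, h using Nat.le_induction with
  | base => rfl
  | succ N h ih => rw [betaSet_succ h, invCount_shift, ih]

theorem hookCount_one (μ : YoungDiagram) : hookCount 1 μ = μ.card :=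
  invCount_one_betaSet le_rfl

theorem colLen_ofBetaSet_le (Y : Finset ℕ) : (ofBetaSet Y).colLen 0 ≤ Y.card := by
  by_contra! h
  rw [← YoungDiagram.mem_iff_lt_colLen, ofBetaSet, YoungDiagram.mem_ofRowLens] at h
  obtain ⟨h, -⟩ := h
  simp at h

/-- In the decreasing enumeration of `Y`, the bead with index `i` has `#Y - 1 - i` beads below it, all
other smaller positions being vacant. -/
theorem betaSet_ofBetaSet (Y : Finset ℕ) : betaSet Y.card (ofBetaSet Y) = Y := by
  have hlen : (Y.sort (· ≥ ·)).length = Y.card := Finset.length_sort _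
  have hgt : (Y.sort (· ≥ ·)).SortedGT := Finset.sortedGT_sort Y
  have key : ∀ i (hi : i < (Y.sort (· ≥ ·)).length),
      (ofBetaSet Y).rowLen i + (Y.card - 1 - i) = (Y.sort (· ≥ ·))[i] := by
    intro i hi
    have hrow : (ofBetaSet Y).rowLen i
        = ((Finset.range (Y.sort (· ≥ ·))[i]).filter (· ∉ Y)).card := by
      have := YoungDiagram.rowLen_ofRowLens
        (hw := (((Y.pairwise_sort (· ≥ ·)).map _ fun a b (hab : a ≥ b) =>
      (Finset.card_le_card (Finset.filter_subset_filter (· ∉ Y)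
        (Finset.range_subset_range.mpr hab)) : _ ≥ _)).sortedGE)) ⟨i, by simpa using hi⟩
      simpa [ofBetaSet] using this
    have hcard : (Y.filter (· < (Y.sort (· ≥ ·))[i])).card = Y.card - 1 - i := by
      rw [show Y.card - 1 - i = (Finset.Ico (i + 1) Y.card).card by rw [Nat.card_Ico]; omega]
      symm
      refine Finset.card_bij
        (fun k hk => (Y.sort (· ≥ ·))[k]'(by rw [hlen]; exact (Finset.mem_Ico.mp hk).2)) ?_ ?_ ?_
      · intro k hk
        rw [Finset.mem_filter]
        refine ⟨(Finset.mem_sort (· ≥ ·)).mp (List.getElem_mem _), ?_⟩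
        exact hgt.getElem_gt_getElem_of_lt (Finset.mem_Ico.mp hk).1
      · intro k hk k' hk' h
        exact (Finset.sort_nodup Y (· ≥ ·)).getElem_inj_iff.mp h
      · intro y hy
        rw [Finset.mem_filter] at hy
        obtain ⟨k, hk, rfl⟩ := List.getElem_of_mem ((Finset.mem_sort (· ≥ ·)).mpr hy.1)
        refine ⟨k, Finset.mem_Ico.mpr ⟨?_, by omega⟩, rfl⟩
        by_contra! hki
        have := hgt.sortedGE.getElem_ge_getElem_of_le (hi := hi) (hj := hk) (Nat.le_of_lt_succ hki)
        omega
    rw [hrow, ← hcard]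
    exact card_vacant_add_card_lt Y _
  ext x
  rw [mem_betaSet, ← Finset.mem_sort (· ≥ ·), List.mem_iff_getElem]
  constructor
  · rintro ⟨i, hi, rfl⟩
    exact ⟨i, by omega, (key i (by omega)).symm⟩
  · rintro ⟨i, hi, rfl⟩
    exact ⟨i, by omega, key i hi⟩

theorem hookCount_ofBetaSet (m : ℕ) (Y : Finset ℕ) : hookCount m (ofBetaSet Y) = invCount m Y := by
  rw [← invCount_betaSet m (colLen_ofBetaSet_le Y), betaSet_ofBetaSet]

/-! ### Deletion of hooks and cores -/

/-- Deleting the rim hook of `(i, j)` replaces the rows `i ≤ a` meeting column `j` by the next row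
shortened by one cell, and the last of them by a row of length `j`. -/
theorem rowLen_deleteHook {μ : YoungDiagram} {i j : ℕ} (h : (i, j) ∈ μ) (a : ℕ) :
    (deleteHook μ (i, j)).rowLen a =
      if a < i ∨ μ.colLen j ≤ a then μ.rowLen a
      else if a + 1 < μ.colLen j then μ.rowLen (a + 1) - 1 else j := by
  refine eq_of_forall_lt_iff fun k => ?_
  have h1 : a + 1 < μ.colLen j ↔ j < μ.rowLen (a + 1) := by
    rw [← YoungDiagram.mem_iff_lt_colLen, YoungDiagram.mem_iff_lt_rowLen]
  have h2 : a < μ.colLen j ↔ j < μ.rowLen a := by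
    rw [← YoungDiagram.mem_iff_lt_colLen, YoungDiagram.mem_iff_lt_rowLen]
  have h3 := μ.rowLen_anti a (a + 1) (Nat.le_succ a)
  have h4 : i < μ.colLen j := YoungDiagram.mem_iff_lt_colLen.mp h
  rw [← YoungDiagram.mem_iff_lt_rowLen]
  have : (a, k) ∈ deleteHook μ (i, j) ↔
      k < μ.rowLen a ∧ ¬ (i ≤ a ∧ j ≤ k ∧ ¬ k + 1 < μ.rowLen (a + 1)) := by
    rw [← YoungDiagram.mem_iff_lt_rowLen, ← YoungDiagram.mem_iff_lt_rowLen,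
      ← YoungDiagram.mem_cells]
    simp [deleteHook]
  rw [this]
  split_ifs <;> omega

/-- Deleting a hook of length `h` moves one bead from a position `y + h` to a vacant position `y`. -/
theorem exists_betaSet_deleteHook {μ : YoungDiagram} {c : ℕ × ℕ} (hc : c ∈ μ) {N : ℕ}
    (hN : μ.colLen 0 ≤ N) :
    ∃ y, y + hookLength μ c ∈ betaSet N μ ∧ y ∉ betaSet N μ ∧
      betaSet N (deleteHook μ c) = moveBead (betaSet N μ) (y + hookLength μ c) y := by
  obtain ⟨i, j⟩ := c
  have hi : i < μ.colLen j := YoungDiagram.mem_iff_lt_colLen.mp hc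
  have hj : j < μ.rowLen i := YoungDiagram.mem_iff_lt_rowLen.mp hc
  have hl : μ.colLen j ≤ N := (μ.colLen_anti 0 j (Nat.zero_le j)).trans hN
  have hb : j + (N - μ.colLen j) + hookLength μ (i, j) = μ.rowLen i + (N - 1 - i) := by
    simp only [hookLength]
    omega
  have hmem : ∀ a, a < μ.colLen j ↔ j < μ.rowLen a := fun a => by
    rw [← YoungDiagram.mem_iff_lt_colLen, YoungDiagram.mem_iff_lt_rowLen]
  refine ⟨j + (N - μ.colLen j), ?_, ?_, ?_⟩
  · exact mem_betaSet.mpr ⟨i, by omega, hb.symm⟩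
  · rw [mem_betaSet]
    rintro ⟨a, ha, h⟩
    have := hmem a
    omega
  · rw [hb]
    ext x
    simp only [moveBead, Finset.mem_insert, Finset.mem_erase, mem_betaSet]
    constructor
    · rintro ⟨a, ha, rfl⟩
      rw [rowLen_deleteHook hc]
      split_ifs with h1 h2
      · refine .inr ⟨fun h => ?_, a, ha, rfl⟩
        have := injOn_beta μ N (Finset.mem_coe.mpr (Finset.mem_range.mpr ha))
          (Finset.mem_coe.mpr (Finset.mem_range.mpr (by omega : i < N))) h
        omega
      · have := (hmem (a + 1)).mp h2
        have := beta_lt_beta μ (N := N) (show i < a + 1 by omega) (by omega)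
        exact .inr ⟨by omega, a + 1, by omega, by omega⟩
      · exact .inl (by omega)
    · rintro (rfl | ⟨hne, a, ha, rfl⟩)
      · refine ⟨μ.colLen j - 1, by omega, ?_⟩
        rw [rowLen_deleteHook hc, if_neg (by omega), if_neg (by omega)]
        omega
      · by_cases h1 : a < i ∨ μ.colLen j ≤ a
        · exact ⟨a, ha, by rw [rowLen_deleteHook hc, if_pos h1]⟩
        · have hai : a ≠ i := by rintro rfl; exact hne rfl
          have := (hmem a).mp (by omega)
          refine ⟨a - 1, by omega, ?_⟩
          rw [rowLen_deleteHook hc, if_neg (by omega), if_pos (by omega),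
            Nat.sub_add_cancel (by omega)]
          omega

/-- Every bead with a vacant position below it comes from a hook whose length is their distance. -/
theorem exists_hookLength_eq {μ : YoungDiagram} {N : ℕ} (hN : μ.colLen 0 ≤ N) {b y : ℕ}
    (hb : b ∈ betaSet N μ) (hy : y ∉ betaSet N μ) (hyb : y < b) :
    ∃ c ∈ μ, hookLength μ c = b - y := by
  obtain ⟨i, hi, rfl⟩ := mem_betaSet.mp hb
  simp only [mem_betaSet, not_exists, not_and] at hy
  classical
  -- The row is that of the bead `b`; the column is the one whose length is the number `l` of beads
  -- above `y`.
  have hex : ∃ l, N ≤ l ∨ μ.rowLen l + (N - 1 - l) < y := ⟨N, .inl le_rfl⟩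
  obtain ⟨l, hl, hmin⟩ : ∃ l, (N ≤ l ∨ μ.rowLen l + (N - 1 - l) < y) ∧
      ∀ a < l, a < N ∧ y < μ.rowLen a + (N - 1 - a) := by
    refine ⟨Nat.find hex, Nat.find_spec hex, fun a ha => ?_⟩
    have h1 := Nat.find_min hex ha
    have h2 := hy a (by omega)
    omega
  have hlN : l ≤ N := by
    by_contra! h
    have := (hmin N h).1
    omega
  have hil : i < l := by
    by_contra! h
    rcases h.eq_or_lt with rfl | h
    · omega
    · have := beta_lt_beta μ h hi
      omega
  have h1 : y + l - N < μ.rowLen (l - 1) := by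
    have := (hmin (l - 1) (by omega)).2
    omega
  have h2 : μ.rowLen l ≤ y + l - N := by
    rcases hl with h | h
    · rw [rowLen_eq_zero (by omega)]
      omega
    · omega
  have hyl : N ≤ y + l := by omega
  have hcol : μ.colLen (y + l - N) = l := by
    rw [← YoungDiagram.mem_iff_lt_rowLen, YoungDiagram.mem_iff_lt_colLen] at h1
    rw [← not_lt, ← YoungDiagram.mem_iff_lt_rowLen, YoungDiagram.mem_iff_lt_colLen] at h2
    omega
  have hmem : (i, y + l - N) ∈ μ := by
    rw [YoungDiagram.mem_iff_lt_colLen, hcol]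
    exact hil
  refine ⟨_, hmem, ?_⟩
  rw [YoungDiagram.mem_iff_lt_rowLen] at hmem
  simp only [hookLength, hcol]
  omega

theorem hookCount_eq_zero_of_isCore {t : ℕ} {μ : YoungDiagram} (h : IsCore t μ) :
    hookCount t μ = 0 := by
  rw [hookCount, invCount]
  refine Finset.sum_eq_zero fun b hb => ?_
  rw [Finset.card_eq_zero, Finset.filter_eq_empty_iff]
  rintro y hy ⟨hyB, hdvd⟩
  obtain ⟨c, hc, hcl⟩ := exists_hookLength_eq le_rfl hb hyB (Finset.mem_range.mp hy)
  exact h c hc (hcl ▸ hdvd)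

theorem colLen_deleteHook_le (μ : YoungDiagram) (c : ℕ × ℕ) :
    (deleteHook μ c).colLen 0 ≤ μ.colLen 0 := by
  by_contra! h
  rw [← YoungDiagram.mem_iff_lt_colLen, ← YoungDiagram.mem_cells] at h
  have := YoungDiagram.mem_iff_lt_colLen.mp (Finset.mem_filter.mp h).1
  omega

theorem hookCount_deleteHook {μ : YoungDiagram} {c : ℕ × ℕ} (hc : c ∈ μ) {m k : ℕ} (hm : 0 < m)
    (hk : hookLength μ c = m * k) : hookCount m (deleteHook μ c) + k = hookCount m μ := by
  obtain ⟨y, hb, hy, h⟩ := exists_betaSet_deleteHook hc le_rfl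
  rw [← invCount_betaSet m (colLen_deleteHook_le μ c), h, hk, hookCount]
  exact invCount_moveBead hm _ (hk ▸ hb) hy

/-- Deleting a hook of length `t * k` lowers the size by `t * k` and `hookCount t` by `k`, so
`μ.card - t * hookCount t μ` is invariant under deletions. -/
theorem card_add_hookCount_of_reflTransGen {t : ℕ} (ht : 0 < t) {μ ν : YoungDiagram}
    (h : Relation.ReflTransGen (DeleteStep t) μ ν) :
    μ.card + t * hookCount t ν = ν.card + t * hookCount t μ := by
  induction h with
  | refl => rfl
  | tail _ hstep ih =>
    obtain ⟨c, hc, ⟨k, hk⟩, rfl⟩ := hstep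
    have h1 := hookCount_deleteHook hc ht hk
    have h2 := hookCount_deleteHook hc one_pos (hk.trans (one_mul _).symm)
    rw [hookCount_one, hookCount_one] at h2
    rw [← h1, mul_add] at ih
    omega

/-- Only the existence of a deletion sequence ending in `core t μ` is used, so this holds whichever
core has been chosen. -/
theorem card_eq_card_core_add {t : ℕ} (ht : 0 < t) (μ : YoungDiagram) :
    μ.card = (core t μ).card + t * hookCount t μ := by
  obtain ⟨h1, h2⟩ := (exists_core t μ).choose_spec
  have := card_add_hookCount_of_reflTransGen ht h1
  rwa [hookCount_eq_zero_of_isCore h2, mul_zero, add_zero] at this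

theorem hookCount_eq_zero_of_card_lt {t : ℕ} {μ : YoungDiagram} (h : μ.card < t) :
    hookCount t μ = 0 := by
  by_contra h0
  have h1 := card_eq_card_core_add (Nat.zero_lt_of_lt h) μ
  have := Nat.le_mul_of_pos_right t (Nat.pos_of_ne_zero h0)
  omega

/-! ### Quotients, the core tower and the defect -/

theorem sum_hookCount_quotient {t : ℕ} (ht : 0 < t) (m : ℕ) (μ : YoungDiagram) :
    ((quotient t μ).map (hookCount m)).sum = hookCount (t * m) μ := by
  rw [← invCount_betaSet (t * m) (Nat.le_mul_of_pos_left (μ.colLen 0) ht),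
    ← sum_invCount_runner ht, quotient, List.map_map]
  change (List.map _ _).sum = (List.map _ (List.range t)).sum
  congr 2
  ext r
  exact hookCount_ofBetaSet m _

/-- With `m = 1` the left side is the total size of row `j` of the pre-tower, which is therefore the
number of hooks of length divisible by `t ^ j`. -/
theorem sum_hookCount_preTowerRow {t : ℕ} (ht : 0 < t) (m : ℕ) (μ : YoungDiagram) (j : ℕ) :
    ((preTowerRow t μ j).map (hookCount m)).sum = hookCount (t ^ j * m) μ := by
  induction j generalizing m with
  | zero => simp [preTowerRow]
  | succ j ih =>
    rw [pow_succ, mul_assoc, ← ih, preTowerRow]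
    generalize preTowerRow t μ j = L
    induction L with
    | nil => rfl
    | cons ν L ih' => simp [ih', sum_hookCount_quotient ht]

theorem totalSize_towerRow {t : ℕ} (ht : 0 < t) (μ : YoungDiagram) (j : ℕ) :
    totalSize (towerRow t μ j) + t * hookCount (t ^ (j + 1)) μ = hookCount (t ^ j) μ := by
  rw [pow_succ, ← sum_hookCount_preTowerRow ht, ← mul_one (t ^ j),
    ← sum_hookCount_preTowerRow ht, totalSize, towerRow]
  generalize preTowerRow t μ j = L
  induction L with
  | nil => rfl
  | cons ν L ih =>
    have := card_eq_card_core_add ht ν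
    simp only [List.map_cons, List.sum_cons, hookCount_one, mul_add] at ih ⊢
    omega

/-- No hook is longer than `μ.card < t ^ j`, so rows from `μ.card` on consist of empty partitions. -/
theorem totalSize_towerRow_eq_zero {t : ℕ} (ht : 2 ≤ t) {μ : YoungDiagram} {j : ℕ}
    (hj : μ.card ≤ j) :
    totalSize (towerRow t μ j) = 0 := by
  have h1 := totalSize_towerRow (by omega) μ j (t := t)
  have h2 : hookCount (t ^ j) μ = 0 :=
    hookCount_eq_zero_of_card_lt (hj.trans_lt (Nat.lt_pow_self (by omega)))
  omega

/-- Row `j` of the tower has total size `H j - t * H (j + 1)`, where `H j` is the number of hooks of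
length divisible by `t ^ j`; the sum over `j` telescopes. -/
theorem defect_eq_sum {t : ℕ} (ht : 2 ≤ t) {μ : YoungDiagram} {M : ℕ} (hM : μ.card ≤ M) :
    defect t μ = ∑ j ∈ Finset.range M, (hookCount (t ^ (j + 1)) μ : ℚ) := by
  have hfin : ∑ᶠ j : ℕ, (totalSize (towerRow t μ j) : ℚ)
      = ∑ j ∈ Finset.range M, (totalSize (towerRow t μ j) : ℚ) := by
    refine finsum_eq_finsetSum_of_support_subset _ fun j hj => ?_
    rw [Function.mem_support] at hj
    rw [Finset.coe_range, Set.mem_Iio]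
    by_contra! h
    exact hj (by rw [totalSize_towerRow_eq_zero ht (hM.trans h), Nat.cast_zero])
  have htel : ∀ j, (totalSize (towerRow t μ j) : ℚ)
      = (hookCount (t ^ j) μ : ℚ) - hookCount (t ^ (j + 1)) μ
        - ((t : ℚ) - 1) * hookCount (t ^ (j + 1)) μ := fun j => by
    have := totalSize_towerRow (by omega) μ j (t := t)
    have : (totalSize (towerRow t μ j) : ℚ) + t * hookCount (t ^ (j + 1)) μ
      = hookCount (t ^ j) μ := by exact_mod_cast this
    linarith
  have hlast : hookCount (t ^ M) μ = 0 :=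
    hookCount_eq_zero_of_card_lt (hM.trans_lt (Nat.lt_pow_self (by omega)))
  have ht' : (t : ℚ) - 1 ≠ 0 := by
    have : (2 : ℚ) ≤ t := by exact_mod_cast ht
    linarith
  rw [defect, hfin, div_eq_iff ht']
  simp_rw [htel]
  rw [Finset.sum_sub_distrib, Finset.sum_range_sub' (fun j => (hookCount (t ^ j) μ : ℚ)),
    ← Finset.mul_sum, hlast, pow_zero, hookCount_one]
  push_cast
  ring

/-! ### Partitions of `n` as bead sets -/

theorem eq_of_betaSet_eq {μ ν : YoungDiagram} {N : ℕ} (hμ : μ.colLen 0 ≤ N) (hν : ν.colLen 0 ≤ N)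
    (h : betaSet N μ = betaSet N ν) : μ = ν := by
  have hanti (κ : YoungDiagram) : StrictAnti fun i : Fin N => κ.rowLen i + (N - 1 - i) :=
    fun i k hik => beta_lt_beta κ hik k.isLt
  have hrange (κ : YoungDiagram) :
      Set.range (fun i : Fin N => κ.rowLen i + (N - 1 - i)) = betaSet N κ := by
    ext x
    simp only [Set.mem_range, Finset.mem_coe, mem_betaSet]
    exact ⟨fun ⟨i, hi⟩ => ⟨i, i.isLt, hi⟩, fun ⟨i, hi, h⟩ => ⟨⟨i, hi⟩, h⟩⟩
  have hfun := ((hanti μ).range_inj (hanti ν)).mp (by rw [hrange, hrange, h])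
  have hrow (i : ℕ) : μ.rowLen i = ν.rowLen i := by
    rcases lt_or_ge i N with hi | hi
    · exact Nat.add_right_cancel (congrFun hfun ⟨i, hi⟩)
    · rw [rowLen_eq_zero (hμ.trans hi), rowLen_eq_zero (hν.trans hi)]
  ext ⟨i, j⟩
  rw [YoungDiagram.mem_cells, YoungDiagram.mem_cells, YoungDiagram.mem_iff_lt_rowLen,
    YoungDiagram.mem_iff_lt_rowLen, hrow]

theorem sum_rowLens (μ : YoungDiagram) : μ.rowLens.sum = μ.card :=
  (card_eq_sum_rowLen le_rfl).symm

theorem rowLens_diagram {n : ℕ} (p : n.Partition) :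
    (diagram p).rowLens = p.parts.sort (· ≥ ·) :=
  YoungDiagram.rowLens_ofRowLens_eq_self fun _ hx => p.parts_pos ((Multiset.mem_sort _).mp hx)

theorem coe_rowLens_diagram {n : ℕ} (p : n.Partition) :
    ((diagram p).rowLens : Multiset ℕ) = p.parts := by
  rw [rowLens_diagram, Multiset.sort_eq]

theorem card_diagram {n : ℕ} (p : n.Partition) : (diagram p).card = n := by
  rw [← sum_rowLens, ← Multiset.sum_coe, coe_rowLens_diagram, p.parts_sum]

theorem colLen_diagram_le {n : ℕ} (p : n.Partition) : (diagram p).colLen 0 ≤ n :=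
  (colLen_zero_le_card _).trans (card_diagram p).le

theorem diagram_injective (n : ℕ) : Function.Injective (diagram (n := n)) := fun p q h => by
  ext1
  rw [← coe_rowLens_diagram, ← coe_rowLens_diagram, h]

theorem exists_diagram_eq (μ : YoungDiagram) : ∃ p : μ.card.Partition, diagram p = μ := by
  refine ⟨⟨μ.rowLens, fun h => μ.pos_of_mem_rowLens _ h, ?_⟩, ?_⟩
  · rw [Multiset.sum_coe, sum_rowLens]
  · refine YoungDiagram.equivListRowLens.injective (Subtype.ext ?_)
    refine List.Perm.eq_of_sortedGE (YoungDiagram.rowLens_sorted _) μ.rowLens_sorted ?_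
    exact Multiset.coe_eq_coe.mp (coe_rowLens_diagram _)

/-- The `N`-element bead sets that encode partitions of `n`. Beads of such a set are less than
`n + N`, see `mem_beadSets`, so the ambient range is no restriction. For `n ≤ N` every partition of `n`
occurs, see `sum_partition_betaSet`. -/
def beadSets (N n : ℕ) : Finset (Finset ℕ) :=
  ((Finset.range (n + N)).powersetCard N).filter fun Y => invCount 1 Y = n

theorem mem_beadSets {N n : ℕ} {Y : Finset ℕ} :
    Y ∈ beadSets N n ↔ Y.card = N ∧ invCount 1 Y = n := by
  rw [beadSets, Finset.mem_filter, Finset.mem_powersetCard]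
  refine ⟨fun h => ⟨h.1.2, h.2⟩, fun h => ⟨⟨fun b hb => ?_, h.1⟩, h.2⟩⟩
  have h1 : ((Finset.range b).filter (· ∉ Y)).card ≤ invCount 1 Y := by
    rw [invCount_one]
    exact Finset.single_le_sum
      (f := fun b => ((Finset.range b).filter (· ∉ Y)).card) (fun _ _ => Nat.zero_le _) hb
  have h2 : (Y.filter (· < b)).card < Y.card :=
    Finset.card_lt_card (Finset.filter_ssubset.mpr ⟨b, hb, lt_irrefl b⟩)
  have h3 := card_vacant_add_card_lt Y b
  rw [Finset.mem_range]
  omega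

theorem sum_partition_betaSet {n N : ℕ} (h : n ≤ N) (f : Finset ℕ → ℕ) :
    ∑ p : n.Partition, f (betaSet N (diagram p)) = ∑ Y ∈ beadSets N n, f Y := by
  refine Finset.sum_bij (fun p _ => betaSet N (diagram p)) ?_ ?_ ?_ fun _ _ => rfl
  · intro p _
    rw [mem_beadSets, invCount_one_betaSet ((colLen_diagram_le p).trans h), card_diagram]
    exact ⟨card_betaSet _ _, rfl⟩
  · intro p _ q _ hpq
    exact diagram_injective n (eq_of_betaSet_eq ((colLen_diagram_le p).trans h)
      ((colLen_diagram_le q).trans h) hpq)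
  · intro Y hY
    obtain ⟨rfl, h2⟩ := mem_beadSets.mp hY
    rw [← hookCount_ofBetaSet, hookCount_one] at h2
    subst h2
    obtain ⟨p, hp⟩ := exists_diagram_eq (ofBetaSet Y)
    exact ⟨p, Finset.mem_univ p, by rw [hp, betaSet_ofBetaSet]⟩

theorem card_beadSets {n N : ℕ} (h : n ≤ N) :
    (beadSets N n).card = Fintype.card n.Partition := by
  have := sum_partition_betaSet h fun _ => 1
  simpa using this.symm

/-! ### Counting hooks over all partitions of `n` -/

/-- The beads of `Y` that can be moved down by `L`: the hooks of length `L` that can be deleted. -/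
def removable (L : ℕ) (Y : Finset ℕ) : Finset ℕ := Y.filter fun b => L ≤ b ∧ b - L ∉ Y

/-- The beads of `Y` that can be moved up by `L`: the hooks of length `L` that can be added. -/
def addable (L : ℕ) (Y : Finset ℕ) : Finset ℕ := Y.filter fun y => y + L ∉ Y

/-- The beads `y` with `y + L ∈ Y` are as many as the beads `b ≥ L` with `b - L ∈ Y`; compare both
complements. -/
theorem card_addable (L : ℕ) (Y : Finset ℕ) :
    (addable L Y).card = (removable L Y).card + (Y.filter (· < L)).card := by
  have h1 := Finset.card_filter_add_card_filter_not (s := Y) fun y => y + L ∈ Y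
  have h2 := Finset.card_filter_add_card_filter_not (s := Y) (· < L)
  have h3 := Finset.card_filter_add_card_filter_not (s := Y.filter fun b => ¬ b < L)
    fun b => b - L ∈ Y
  have h4 : (Y.filter fun y => y + L ∈ Y).card
      = ((Y.filter fun b => ¬ b < L).filter fun b => b - L ∈ Y).card := by
    refine Finset.card_nbij' (· + L) (· - L) ?_ ?_ ?_ ?_
    · intro y hy; simp at hy ⊢; exact ⟨hy.2, hy.1⟩
    · intro y hy
      simp at hy ⊢
      rw [Nat.sub_add_cancel hy.1.2]
      exact ⟨hy.2, hy.1.1⟩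
    · intro y _; simp
    · intro y hy
      simp at hy
      exact Nat.sub_add_cancel hy.1.2
  rw [Finset.filter_filter] at h3
  simp only [not_lt] at h2 h3 h4
  have h5 : (Y.filter fun b => L ≤ b ∧ ¬ b - L ∈ Y).card = (removable L Y).card := rfl
  have h6 : (Y.filter fun y => ¬ y + L ∈ Y).card = (addable L Y).card := rfl
  rw [Finset.filter_filter] at h3
  rw [Finset.filter_filter] at h4
  omega

/-- With enough beta numbers the positions below `L` are all occupied. -/
theorem filter_lt_eq_range {N n L : ℕ} {Y : Finset ℕ} (hY : Y ∈ beadSets N n) (h : n + L ≤ N) :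
    Y.filter (· < L) = Finset.range L := by
  obtain ⟨h1, h2⟩ := mem_beadSets.mp hY
  ext y
  rw [Finset.mem_filter, Finset.mem_range, and_iff_right_iff_imp]
  intro hyL
  by_contra hy
  have h3 : (Y.filter fun b => ¬ b < y).card ≤ invCount 1 Y := by
    rw [invCount_one, ← Finset.sum_filter_add_sum_filter_not Y (· < y), Finset.card_eq_sum_ones]
    refine le_add_left (Finset.sum_le_sum fun b hb => ?_)
    rw [Finset.mem_filter] at hb
    have hby : b ≠ y := by rintro rfl; exact hy hb.1
    exact Finset.card_pos.mpr ⟨y, by simp; exact ⟨by omega, hy⟩⟩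
  have h4 := Finset.card_filter_add_card_filter_not (s := Y) (· < y)
  have h5 := card_vacant_add_card_lt Y y
  omega

theorem moveBead_mem_beadSets {N n L b : ℕ} {Y : Finset ℕ} (hb : b + L ∈ Y) (hy : b ∉ Y) :
    moveBead Y (b + L) b ∈ beadSets N n ↔ Y ∈ beadSets N (n + L) := by
  have h := invCount_moveBead one_pos Y (b := b) (k := L) (by rwa [one_mul]) hy
  rw [one_mul] at h
  rw [mem_beadSets, mem_beadSets, card_moveBead Y hb hy]
  omega

theorem moveBead_moveBead {Y : Finset ℕ} {b y : ℕ} (hb : b ∈ Y) (hy : y ∉ Y) :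
    moveBead (moveBead Y b y) y b = Y := by
  ext x
  simp only [moveBead, Finset.mem_insert, Finset.mem_erase]
  grind

/-- Moving the marked bead by `L` is a bijection between partitions of `n + L` with a marked hook of
length `L` that can be deleted and partitions of `n` with a marked one that can be added. -/
theorem sum_card_removable_add {N n L : ℕ} (hL : 0 < L) :
    ∑ Y ∈ beadSets N (n + L), (removable L Y).card = ∑ Y ∈ beadSets N n, (addable L Y).card := by
  rw [← Finset.card_sigma, ← Finset.card_sigma]
  refine Finset.card_nbij' (fun x => ⟨moveBead x.1 x.2 (x.2 - L), x.2 - L⟩)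
    (fun x => ⟨moveBead x.1 x.2 (x.2 + L), x.2 + L⟩) ?_ ?_ ?_ ?_
  · rintro ⟨Y, b⟩ h
    simp only [Finset.coe_sigma, Set.mem_sigma_iff, Finset.mem_coe, removable,
      Finset.mem_filter, addable] at h ⊢
    obtain ⟨hY, hb, hLb, hb'⟩ := h
    obtain ⟨y, rfl⟩ := Nat.exists_eq_add_of_le' hLb
    rw [Nat.add_sub_cancel] at hb' ⊢
    refine ⟨(moveBead_mem_beadSets hb hb').mpr hY, by simp [moveBead], ?_⟩
    simp only [moveBead, Finset.mem_insert, Finset.mem_erase]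
    omega
  · rintro ⟨Y, y⟩ h
    simp only [Finset.coe_sigma, Set.mem_sigma_iff, Finset.mem_coe, removable,
      Finset.mem_filter, addable] at h ⊢
    obtain ⟨hY, hy, hy'⟩ := h
    rw [Nat.add_sub_cancel]
    have h1 : y + L ∈ moveBead Y y (y + L) := by simp [moveBead]
    have h2 : y ∉ moveBead Y y (y + L) := by
      simp only [moveBead, Finset.mem_insert, Finset.mem_erase]
      omega
    refine ⟨?_, h1, by omega, h2⟩
    rw [← moveBead_mem_beadSets h1 h2, moveBead_moveBead hy hy']
    exact hY
  · rintro ⟨Y, b⟩ h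
    simp only [Finset.coe_sigma, Set.mem_sigma_iff, Finset.mem_coe, removable,
      Finset.mem_filter] at h
    obtain ⟨hY, hb, hLb, hb'⟩ := h
    simp only [Nat.sub_add_cancel hLb, moveBead_moveBead hb hb']
  · rintro ⟨Y, y⟩ h
    simp only [Finset.coe_sigma, Set.mem_sigma_iff, Finset.mem_coe,
      Finset.mem_filter, addable] at h
    obtain ⟨hY, hy, hy'⟩ := h
    simp only [Nat.add_sub_cancel, moveBead_moveBead hy hy']

/-- The number of hooks of length `L` in all partitions of `n` is `L * ∑ p(n - a)` over the positive
multiples `a` of `L`. A bead set has `L` more addable than removable hooks of length `L`, so this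
number grows by `L * p(n)` from `n` to `n + L`. -/
theorem sum_card_removable {N L : ℕ} (hL : 0 < L) (n : ℕ) (hn : n ≤ N) :
    ∑ Y ∈ beadSets N n, (removable L Y).card =
      ∑ a ∈ Finset.range (n + 1),
        if L ∣ a ∧ a ≠ 0 then L * Fintype.card (n - a).Partition else 0 := by
  induction n using Nat.strong_induction_on with
  | _ n ih =>
    rcases lt_or_ge n L with h | h
    · rw [Finset.sum_eq_zero, Finset.sum_eq_zero]
      · intro a ha
        rw [Finset.mem_range] at ha
        refine if_neg fun ⟨h1, h2⟩ => ?_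
        have := Nat.le_of_dvd (Nat.pos_of_ne_zero h2) h1
        omega
      · intro Y hY
        rw [Finset.card_eq_zero, removable, Finset.filter_eq_empty_iff]
        rintro b hb ⟨h1, h2⟩
        have h3 := invCount_moveBead one_pos Y (b := b - L) (k := L)
          (by rwa [one_mul, Nat.sub_add_cancel h1]) h2
        rw [(mem_beadSets.mp hY).2] at h3
        omega
    · obtain ⟨k, rfl⟩ := Nat.exists_eq_add_of_le' h
      have h1 : ∀ Y ∈ beadSets N k, (addable L Y).card = (removable L Y).card + L := by
        intro Y hY
        rw [card_addable, filter_lt_eq_range hY hn, Finset.card_range]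
      rw [sum_card_removable_add hL, Finset.sum_congr rfl h1, Finset.sum_add_distrib,
        ih k (by omega) (by omega), Finset.sum_const, card_beadSets (by omega),
        show k + L + 1 = L + (k + 1) by omega, Finset.sum_range_add _ L]
      have h2 : ∑ a ∈ Finset.range L,
          (if L ∣ a ∧ a ≠ 0 then L * Fintype.card (k + L - a).Partition else 0) = 0 := by
        refine Finset.sum_eq_zero fun a ha => if_neg fun ⟨h1, h2⟩ => ?_
        have := Nat.le_of_dvd (Nat.pos_of_ne_zero h2) h1
        rw [Finset.mem_range] at ha
        omega
      rw [h2, zero_add, Finset.sum_range_succ', Finset.sum_range_succ']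
      have h3 (a : ℕ) : k + L - (L + a) = k - a := by omega
      simp [h3, hL.ne', mul_comm]

theorem invCount_eq_sum_card_removable (m : ℕ) {Y : Finset ℕ} {M : ℕ} (hM : ∀ b ∈ Y, b ≤ M) :
    invCount m Y = ∑ L ∈ Finset.Icc 1 M with m ∣ L, (removable L Y).card := by
  simp only [removable, Finset.card_filter, invCount]
  rw [Finset.sum_comm]
  refine Finset.sum_congr rfl fun b hb => ?_
  rw [← Finset.card_filter, ← Finset.card_filter]
  have := hM b hb
  refine Finset.card_nbij' (b - ·) (b - ·) ?_ ?_ ?_ ?_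
  · intro y hy
    simp at hy ⊢
    rw [Nat.sub_sub_self hy.1.le]
    exact ⟨⟨⟨by omega, by omega⟩, hy.2.2⟩, hy.2.1⟩
  · intro L hL
    simp at hL ⊢
    rw [Nat.sub_sub_self hL.2.1]
    exact ⟨by omega, hL.2.2, hL.1.2⟩
  · intro y hy
    simp at hy
    exact Nat.sub_sub_self hy.1.le
  · intro L hL
    simp at hL
    exact Nat.sub_sub_self hL.2.1

theorem sum_dvd_dvd {m a M : ℕ} (hm : 0 < m) (ha : a ≠ 0) (haM : a ≤ M) :
    ∑ L ∈ Finset.Icc 1 M with m ∣ L, (if L ∣ a then L else 0) =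
      if m ∣ a then m * ArithmeticFunction.sigma 1 (a / m) else 0 := by
  rw [← Finset.sum_filter, Finset.filter_filter]
  split_ifs with h
  · obtain ⟨k, rfl⟩ := h
    have hk : k ≠ 0 := by rintro rfl; simp at ha
    rw [Nat.mul_div_cancel_left _ hm, ArithmeticFunction.sigma_one_apply, Finset.mul_sum]
    symm
    refine Finset.sum_bij (fun d _ => m * d) ?_ ?_ ?_ fun _ _ => rfl
    · intro d hd
      have hd := Nat.dvd_of_mem_divisors hd
      have h1 : m * d ∣ m * k := Nat.mul_dvd_mul_left m hd
      simp only [Finset.mem_filter, Finset.mem_Icc]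
      have := Nat.mul_pos hm (Nat.pos_of_dvd_of_pos hd (Nat.pos_of_ne_zero hk))
      exact ⟨⟨this, (Nat.le_of_dvd (Nat.pos_of_ne_zero ha) h1).trans haM⟩, dvd_mul_right m d, h1⟩
    · intro d _ e _ h
      exact Nat.eq_of_mul_eq_mul_left hm h
    · intro L hL
      simp only [Finset.mem_filter, Finset.mem_Icc] at hL
      obtain ⟨-, ⟨d, rfl⟩, h⟩ := hL
      exact ⟨d, Nat.mem_divisors.mpr ⟨Nat.dvd_of_mul_dvd_mul_left hm h, hk⟩, rfl⟩
  · rw [Finset.filter_false_of_mem, Finset.sum_empty]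
    exact fun L _ hL => h (hL.1.trans hL.2)

theorem sum_partition_hookCount {m : ℕ} (hm : 0 < m) (n : ℕ) :
    ∑ p : n.Partition, hookCount m (diagram p) =
      ∑ a ∈ Finset.range (n + 1),
        (if m ∣ a then m * ArithmeticFunction.sigma 1 (a / m) else 0) *
          Fintype.card (n - a).Partition := by
  have h1 : ∀ Y ∈ beadSets n n,
      invCount m Y = ∑ L ∈ Finset.Icc 1 (n + n) with m ∣ L, (removable L Y).card := by
    intro Y hY
    refine invCount_eq_sum_card_removable m fun b hb => ?_
    rw [beadSets, Finset.mem_filter, Finset.mem_powersetCard] at hY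
    exact (Finset.mem_range.mp (hY.1.1 hb)).le
  calc ∑ p : n.Partition, hookCount m (diagram p)
      = ∑ p : n.Partition, invCount m (betaSet n (diagram p)) :=
        Finset.sum_congr rfl fun p _ => (invCount_betaSet m (colLen_diagram_le p)).symm
    _ = ∑ L ∈ Finset.Icc 1 (n + n) with m ∣ L, ∑ Y ∈ beadSets n n, (removable L Y).card := by
        rw [sum_partition_betaSet le_rfl, Finset.sum_congr rfl h1, Finset.sum_comm]
    _ = ∑ L ∈ Finset.Icc 1 (n + n) with m ∣ L, ∑ a ∈ Finset.range (n + 1),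
          if L ∣ a ∧ a ≠ 0 then L * Fintype.card (n - a).Partition else 0 := by
        refine Finset.sum_congr rfl fun L hL => sum_card_removable ?_ n le_rfl
        exact (Finset.mem_Icc.mp (Finset.mem_filter.mp hL).1).1
    _ = _ := by
        rw [Finset.sum_comm]
        refine Finset.sum_congr rfl fun a ha => ?_
        rw [Finset.mem_range] at ha
        rcases eq_or_ne a 0 with rfl | h0
        · simp
        · rw [← sum_dvd_dvd hm h0 (by omega : a ≤ n + n), Finset.sum_mul]
          exact Finset.sum_congr rfl fun L _ => by simp [h0]

/-! ### Generating functions -/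

/-- The generating function `∑ p(n) q^n` of the number of partitions of `n`. -/
noncomputable def partitionSeries : ℚ⟦X⟧ :=
  PowerSeries.mk fun n => (Fintype.card n.Partition : ℚ)

/-- Both factors are infinite products, and the factors with the same index are
`∑ j, q ^ (i * j)` and `1 - q ^ i`. -/
theorem partitionSeries_mul_qInfty : partitionSeries * qInfty = 1 := by
  have h1 : Nat.Partition.genFun (fun _ _ => (1 : ℚ)) = partitionSeries := by
    ext n
    simp [partitionSeries, Finsupp.prod]
  have h2 := Nat.Partition.hasProd_genFun fun _ _ => (1 : ℚ)
  rw [h1] at h2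
  have h3 := h2.mul
    (PowerSeries.WithPiTopology.multipliable_one_sub_X_pow ℚ).hasProd
  refine h3.unique ?_
  convert hasProd_one using 2 with i
  have hX : PowerSeries.constantCoeff (PowerSeries.X ^ (i + 1) : ℚ⟦X⟧) = 0 := by simp
  refine Eq.trans ?_ (PowerSeries.WithPiTopology.tsum_pow_mul_one_sub_of_constantCoeff_eq_zero hX)
  congr 1
  rw [(PowerSeries.WithPiTopology.summable_pow_of_constantCoeff_eq_zero hX).tsum_eq_zero_add]
  simp [← pow_mul]

theorem qInfty_inv : qInfty⁻¹ = partitionSeries := by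
  rw [eq_comm, PowerSeries.eq_inv_iff_mul_eq_one]
  · exact partitionSeries_mul_qInfty
  · intro h
    have := congrArg PowerSeries.constantCoeff partitionSeries_mul_qInfty
    rw [map_mul, h, mul_zero, map_one] at this
    exact zero_ne_one this

theorem coeff_natCast_mul_G20_subst {m : ℕ} (hm : m ≠ 0) (a : ℕ) :
    PowerSeries.coeff a ((m : ℚ⟦X⟧) * G20.subst (PowerSeries.X ^ m : ℚ⟦X⟧)) =
      ((if m ∣ a then m * ArithmeticFunction.sigma 1 (a / m) else 0 : ℕ) : ℚ) := by
  rw [← map_natCast (PowerSeries.C (R := ℚ)), PowerSeries.coeff_C_mul,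
    PowerSeries.coeff_subst_X_pow hm]
  split_ifs <;> simp [G20]

theorem coeff_pow_mul_G20_subst {t : ℕ} (ht : 2 ≤ t) (j a : ℕ) :
    PowerSeries.coeff a ((t : ℚ⟦X⟧) ^ (j + 1) *
      G20.subst (PowerSeries.X ^ t ^ (j + 1) : ℚ⟦X⟧)) = ((if t ^ (j + 1) ∣ a then
        t ^ (j + 1) * ArithmeticFunction.sigma 1 (a / t ^ (j + 1)) else 0 : ℕ) : ℚ) := by
  rw [← Nat.cast_pow]
  exact coeff_natCast_mul_G20_subst (pow_ne_zero _ (by omega)) a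

/-- The case `a = 0` relies on the convention `σ 1 0 = 0`. -/
theorem pow_mul_sigma_eq_zero {t : ℕ} (ht : 2 ≤ t) {j a : ℕ} (haj : a ≤ j) :
    (if t ^ (j + 1) ∣ a then
      t ^ (j + 1) * ArithmeticFunction.sigma 1 (a / t ^ (j + 1)) else 0) = 0 := by
  have : a < t ^ (j + 1) := by
    have := Nat.lt_pow_self (n := j + 1) (show 1 < t by omega)
    omega
  rw [Nat.div_eq_of_lt this]
  simp

theorem hasSum_pow_mul_G20_subst {t : ℕ} (ht : 2 ≤ t) :
    HasSum (fun j : ℕ => (t : ℚ⟦X⟧) ^ (j + 1) *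
      G20.subst (PowerSeries.X ^ t ^ (j + 1) : ℚ⟦X⟧))
      (PowerSeries.mk fun a => ∑ j ∈ Finset.range a, ((if t ^ (j + 1) ∣ a then
        t ^ (j + 1) * ArithmeticFunction.sigma 1 (a / t ^ (j + 1)) else 0 : ℕ) : ℚ)) := by
  rw [PowerSeries.WithPiTopology.hasSum_iff_hasSum_coeff]
  intro a
  simp only [coeff_pow_mul_G20_subst ht, PowerSeries.coeff_mk]
  refine hasSum_sum_of_ne_finset_zero fun j hj => ?_
  rw [Finset.mem_range, not_lt] at hj
  rw [pow_mul_sigma_eq_zero ht hj, Nat.cast_zero]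

theorem defectSeries_eq {t : ℕ} (ht : 2 ≤ t) :
    defectSeries t = (PowerSeries.mk fun a => ∑ j ∈ Finset.range a, ((if t ^ (j + 1) ∣ a then
      t ^ (j + 1) * ArithmeticFunction.sigma 1 (a / t ^ (j + 1)) else 0 : ℕ) : ℚ)) *
        partitionSeries := by
  ext n
  rw [PowerSeries.coeff_mul, Finset.Nat.sum_antidiagonal_eq_sum_range_succ_mk, defectSeries,
    PowerSeries.coeff_mk]
  simp only [PowerSeries.coeff_mk, partitionSeries]
  have h1 : ∀ p : n.Partition, defect t (diagram p)
      = ∑ j ∈ Finset.range n, (hookCount (t ^ (j + 1)) (diagram p) : ℚ) :=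
    fun p => defect_eq_sum ht (card_diagram p).le
  rw [Finset.sum_congr rfl fun p _ => h1 p, Finset.sum_comm]
  have h2 : ∀ j, ∑ p : n.Partition, (hookCount (t ^ (j + 1)) (diagram p) : ℚ) = _ := fun j => by
    rw [← Nat.cast_sum, sum_partition_hookCount (pow_pos (by omega) (j + 1)) n, Nat.cast_sum]
  rw [Finset.sum_congr rfl fun j _ => h2 j, Finset.sum_comm]
  refine Finset.sum_congr rfl fun a ha => ?_
  simp only [Nat.cast_mul (_ : ℕ) (Fintype.card _)]
  rw [← Finset.sum_mul]
  congr 1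
  symm
  refine Finset.sum_subset (Finset.range_mono (Finset.mem_range_succ_iff.mp ha)) ?_
  intro j _ hj
  rw [Finset.mem_range, not_lt] at hj
  rw [pow_mul_sigma_eq_zero ht hj, Nat.cast_zero]

end CoreTower

/-- For `t ≥ 2`, every `t`-core tower has only finitely many rows of nonzero total size (so that the
defect is meaningful), the series `∑_{j ≥ 1} t^j G_2^0(q^(t^j))` converges as a formal power series,
and its quotient by `(q)_∞` is the generating function of the `t`-defect. -/
theorem corollary1p2 (t : ℕ) (ht : 2 ≤ t) :
    (∀ μ : YoungDiagram,
      {j : ℕ | CoreTower.totalSize (CoreTower.towerRow t μ j) ≠ 0}.Finite) ∧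
    Summable (fun j : ℕ => (t : ℚ⟦X⟧) ^ (j + 1) *
      CoreTower.G20.subst (PowerSeries.X ^ t ^ (j + 1) : ℚ⟦X⟧)) ∧
    CoreTower.defectSeries t =
      (∑' j : ℕ, (t : ℚ⟦X⟧) ^ (j + 1) *
        CoreTower.G20.subst (PowerSeries.X ^ t ^ (j + 1) : ℚ⟦X⟧)) *
      (CoreTower.qInfty)⁻¹ := by
  refine ⟨fun μ => (Set.finite_Iio μ.card).subset fun j hj => ?_,
    (CoreTower.hasSum_pow_mul_G20_subst ht).summable, ?_⟩
  · by_contra h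
    exact hj (CoreTower.totalSize_towerRow_eq_zero ht (not_lt.mp h))
  · rw [(CoreTower.hasSum_pow_mul_G20_subst ht).tsum_eq, CoreTower.qInfty_inv,
      CoreTower.defectSeries_eq ht]
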